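/- Let $\mathcal A$ be a finite nonempty alphabet with two strict total orders $<_A$ and $<_D$, and let $W$ be a finite set of finite words over $\mathcal A$. Let $F(W)$ be the set of all factors (contiguous subwords, including the empty word) of words of $W$. A word $v$ of a set of words $L$ is bispecial in $L$ if there are letters $x\ne x'$ and $y\neq y'$ with $xv,x'v,vy,vy'\in L$; $L$ satisfies the order condition for $(<_A,<_D)$ if for every bispecial word $v$ of $L$, whenever $xvy,\ x'vy'\in L$ with letters $x\neq x'$ and $y\neq y'$, one has $x<_A x'$ if and only if $y<_D y'$. All intervals are bounded, closed on the left and open on the right. A generalized interval exchange transformation with alphabet $\mathcal A$ is a map $T$ on an interval $I$ that is partitioned into nonempty intervals $I_e$, $e\in\mathcal A$ (the defining intervals), such that $T$ is continuous and strictly increasing on each $I_e$ and the images $TI_e$, $e\in\mathcal A$, are intervals partitioning $I$. Its pair of orders is $(<_A,<_D)$ if, for all letters $e,f$: $e<_D f$ if and only if $I_e$ lies strictly to the left of $I_f$, and $e<_A f$ if and only if $TI_e$ lies strictly to the left of $TI_f$. Its natural coding $L(T)$ is the set of all finite words occurring in the trajectories $(x_n)_{n\in\mathbb Z}$ of points $x\in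 I$, where $x_n=e$ if $T^nx\in I_e$. A grouped coding of an affine interval exchange transformation with orders $(<_A,<_D)$ is the natural coding of a generalized interval exchange transformation $T$ with pair of orders $(<_A,<_D)$ such that each defining interval is a finite union of subintervals on each of which $T$ is affine. Proposition. $F(W)$ satisfies the order condition for $(<_A,<_D)$ if and only if $W$ is included in a grouped coding of an affine interval exchange transformation with the same orders $(<_A,<_D)$. -/

import Mathlib

/-- The set `F(W)` of all factors (contiguous subwords) of the words of `W`. -/
def factorsOf {A : Type*} (W : Set (List A)) : Set (List A) :=
  {v | ∃ w ∈ W, v <:+: w}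

/-- `v` is right special in `L`: it has more than one right extension `vy` in `L`. -/
def IsRightSpecial {A : Type*} (L : Set (List A)) (v : List A) : Prop :=
  v ∈ L ∧ ∃ y y' : A, y ≠ y' ∧ v ++ [y] ∈ L ∧ v ++ [y'] ∈ L

/-- `v` is left special in `L`: it has more than one left extension `xv` in `L`. -/
def IsLeftSpecial {A : Type*} (L : Set (List A)) (v : List A) : Prop :=
  v ∈ L ∧ ∃ x x' : A, x ≠ x' ∧ x :: v ∈ L ∧ x' :: v ∈ L

/-- A bispecial word of `L` is one that is both left special and right special. -/
def IsBispecial {A : Type*} (L : Set (List A)) (v : List A) : Prop :=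
  IsLeftSpecial L v ∧ IsRightSpecial L v

/-- The order condition of the word `v` of `L` for the pair of orders `(ltA, ltD)`. -/
def WordOrderCondition {A : Type*} (ltA ltD : A → A → Prop) (L : Set (List A))
    (v : List A) : Prop :=
  ∀ x x' y y' : A, x ≠ x' → y ≠ y' →
    x :: (v ++ [y]) ∈ L → x' :: (v ++ [y']) ∈ L → (ltA x x' ↔ ltD y y')

/-- `L` satisfies the order condition for `(ltA, ltD)`: all its bispecial words satisfy it. -/
def OrderCondition {A : Type*} (ltA ltD : A → A → Prop) (L : Set (List A)) : Prop :=
  ∀ v : List A, IsBispecial L v → WordOrderCondition ltA ltD L v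

/-- A generalized interval exchange transformation, given together with its defining intervals
`I_e = [left e, right e)`, `e ∈ A`, which are nonempty. They partition `I = [a, b)`; the map is
continuous and strictly increasing on each of them; and their images are again intervals, closed on
the left and open on the right, which partition `I`.
Only the values of `toFun` on `I` are meaningful. -/
structure GenIET (A : Type*) where
  /-- left endpoint of `I` -/
  a : ℝ
  /-- right endpoint of `I` -/
  b : ℝ
  /-- the map `T` -/
  toFun : ℝ → ℝ
  /-- left endpoints of the defining intervals -/
  left : A → ℝ
  /-- right endpoints of the defining intervals -/
  right : A → ℝ
  left_lt_right : ∀ e, left e < right e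
  disjoint_dom : ∀ e f, e ≠ f → Disjoint (Set.Ico (left e) (right e)) (Set.Ico (left f) (right f))
  iUnion_dom : ⋃ e, Set.Ico (left e) (right e) = Set.Ico a b
  continuousOn : ∀ e, ContinuousOn toFun (Set.Ico (left e) (right e))
  strictMonoOn : ∀ e, StrictMonoOn toFun (Set.Ico (left e) (right e))
  image_interval : ∀ e, ∃ c d : ℝ, toFun '' Set.Ico (left e) (right e) = Set.Ico c d
  disjoint_image : ∀ e f, e ≠ f →
    Disjoint (toFun '' Set.Ico (left e) (right e)) (toFun '' Set.Ico (left f) (right f))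
  iUnion_image : ⋃ e, toFun '' Set.Ico (left e) (right e) = Set.Ico a b

namespace GenIET

/-- The interval `I` on which `T` is defined. -/
def domain {A : Type*} (T : GenIET A) : Set ℝ := Set.Ico T.a T.b

/-- The defining interval `I_e`. -/
def defInterval {A : Type*} (T : GenIET A) (e : A) : Set ℝ := Set.Ico (T.left e) (T.right e)

/-- The order `<_D` of `T`: `I_e` is strictly to the left of `I_f`. -/
def orderD {A : Type*} (T : GenIET A) (e f : A) : Prop :=
  ∀ x ∈ T.defInterval e, ∀ y ∈ T.defInterval f, x < y

/-- The order `<_A` of `T`: `T I_e` is strictly to the left of `T I_f`. -/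
def orderA {A : Type*} (T : GenIET A) (e f : A) : Prop :=
  ∀ x ∈ T.toFun '' T.defInterval e, ∀ y ∈ T.toFun '' T.defInterval f, x < y

/-- `x` is a trajectory of `T`: there is a two-sided orbit `u n = T ^ n (u 0)`, `n ∈ ℤ`, in `I` with
`u n ∈ I_{x n}` for all `n`. Since `T` is a bijection of `I`, every point of `I` has exactly one
such orbit. -/
def IsTrajectory {A : Type*} (T : GenIET A) (x : ℤ → A) : Prop :=
  ∃ u : ℤ → ℝ, (∀ n, u n ∈ T.domain) ∧ (∀ n, u (n + 1) = T.toFun (u n)) ∧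
    ∀ n, u n ∈ T.defInterval (x n)

/-- The natural coding `L(T)`: all finite words that occur in some trajectory of `T`. -/
def naturalCoding {A : Type*} (T : GenIET A) : Set (List A) :=
  {w | ∃ x : ℤ → A, T.IsTrajectory x ∧
    ∃ k : ℤ, ∀ (i : ℕ) (hi : i < w.length), w[i] = x (k + i)}

/-- `T` is piecewise affine on each defining interval: each `I_e` is cut by finitely many points
`c 0 < c 1 < ⋯ < c n` into intervals `[c i, c (i + 1))` on each of which `T` is affine. -/
def IsPiecewiseAffine {A : Type*} (T : GenIET A) : Prop :=
  ∀ e, ∃ (n : ℕ) (c : Fin (n + 1) → ℝ), StrictMono c ∧ c 0 = T.left e ∧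
    c (Fin.last n) = T.right e ∧
    ∀ i : Fin n, ∃ s t : ℝ, ∀ x ∈ Set.Ico (c i.castSucc) (c i.succ), T.toFun x = s * x + t

end GenIET

/-- `L` is a grouped coding, with the pair of orders `(ltA, ltD)`, of an affine interval exchange
transformation: it is the natural coding of a generalized interval exchange transformation with
orders `(ltA, ltD)` that is piecewise affine on each of its defining intervals. -/
def IsGroupedCoding {A : Type*} (ltA ltD : A → A → Prop) (L : Set (List A)) : Prop :=
  ∃ T : GenIET A, T.IsPiecewiseAffine ∧ (∀ e f, T.orderA e f ↔ ltA e f) ∧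
    (∀ e f, T.orderD e f ↔ ltD e f) ∧ L = T.naturalCoding

/-! A transformation with the given orders satisfies the order condition: if two orbits begin in
`I_x` and `I_x'` with `x <_A x'`, their images are ordered in the same way. The branches are
increasing, so the two orbits stay in this order as long as they read the same letters, and the
first differing letters are ordered by `<_D` (`GenIET.rankOrderCondition_naturalCoding`).

Conversely, the factor language embeds in a maximal factorial language with the order condition.
Maximality makes every word of it right extendable, because a compatible next letter always exists
(`exists_compatible_letter`). The words of `W` thus become prefixes of infinite words. Their
positions are ordered lexicographically by the future read with `<_D`, ties being broken by the past
read backwards with `<_A`. The shift is increasing between positions carrying the same letter, and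
the order condition says exactly that it sends positions with `<_A`-smaller letters to smaller
positions (`positionKey_succ_lt_of_letter_lt`). Only finitely many positions are needed to read `W`.
Placing them on the real line in this order and interpolating the shift affinely gives the
transformation (`exists_genIET_interpolating`). -/

/-! ### Piecewise affine interpolation of finite ordered data. -/

/-- Finitely many points of `(a, b)` labelled monotonically by `0, …, r - 1` are separated by the
successive points of a subdivision of `[a, b]` into `r` intervals. -/
theorem exists_strictMono_separating {P : Type*} [Finite P] (a : ℝ) (x : P → ℝ) (ℓ : P → ℕ) :
    ∀ (r : ℕ) (b : ℝ), 0 < r → a < b → (∀ p, ℓ p < r → a < x p ∧ x p < b) →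
    (∀ p q, ℓ p < r → ℓ q < r → ℓ p < ℓ q → x p < x q) →
    ∃ d : ℕ → ℝ, StrictMono d ∧ d 0 = a ∧ d r = b ∧
      ∀ p, ℓ p < r → d (ℓ p) < x p ∧ x p < d (ℓ p + 1) := by
  intro r
  induction r with
  | zero => intro b h; omega
  | succ r ih =>
    intro b _ hab hx hmono
    have := Fintype.ofFinite P
    classical
    rcases Nat.eq_zero_or_pos r with rfl | hr
    · refine ⟨fun n => a + n * (b - a), fun m n hmn => ?_, by simp, by simp, fun p hp => ?_⟩
      · have : (m : ℝ) < n := by exact_mod_cast hmn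
        simp only
        nlinarith
      · obtain ⟨h1, h2⟩ := hx p hp
        have : ℓ p = 0 := by omega
        simp only [this]
        norm_num
        exact ⟨h1, h2⟩
    -- The last interior cut `m` lies above all points with label less than `r` and below all those
    -- with label `r`. Inserting `a` and `b` keeps it inside the interval even when one of these
    -- sets is empty.
    · obtain ⟨m, hlo, hhi⟩ := Order.exists_between_finsets
        (insert a ((Finset.univ.filter (fun p => ℓ p < r)).image x))
        (insert b ((Finset.univ.filter (fun p => ℓ p = r)).image x)) (by
          intro u hu v hv
          simp only [Finset.mem_insert, Finset.mem_image, Finset.mem_filter, Finset.mem_univ,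
            true_and] at hu hv
          rcases hu with rfl | ⟨p, hp, rfl⟩ <;> rcases hv with rfl | ⟨q, hq, rfl⟩
          · exact hab
          · exact (hx q (by omega)).1
          · exact (hx p (by omega)).2
          · exact hmono p q (by omega) (by omega) (by omega))
      have ham : a < m := hlo a (by simp)
      have hmb : m < b := hhi b (by simp)
      have hlo' : ∀ p, ℓ p < r → x p < m := fun p hp => hlo _ (by
        simp only [Finset.mem_insert, Finset.mem_image, Finset.mem_filter, Finset.mem_univ,
          true_and]
        exact Or.inr ⟨p, hp, rfl⟩)
      have hhi' : ∀ p, ℓ p = r → m < x p := fun p hp => hhi _ (by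
        simp only [Finset.mem_insert, Finset.mem_image, Finset.mem_filter, Finset.mem_univ,
          true_and]
        exact Or.inr ⟨p, hp, rfl⟩)
      obtain ⟨d, hd, hd0, hdr, hdx⟩ := ih m hr ham
        (fun p hp => ⟨(hx p (by omega)).1, hlo' p hp⟩)
        (fun p q hp hq => hmono p q (by omega) (by omega))
      -- The values beyond `r + 1` only serve to keep the sequence strictly increasing on all of
      -- `ℕ`.
      refine ⟨fun n => if n ≤ r then d n else b + (n - (r + 1)), strictMono_nat_of_lt_succ ?_,
        by simp [hd0], by simp, fun p hp => ?_⟩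
      · intro n
        rcases lt_trichotomy n r with h | rfl | h
        · simp only [h.le, Nat.succ_le_of_lt h, if_true]
          exact hd (Nat.lt_succ_self n)
        · simp [hdr, hmb]
        · have h1 : ¬ n ≤ r := by omega
          have h2 : ¬ n + 1 ≤ r := by omega
          simp [h1, h2]
      · rcases Nat.lt_succ_iff_lt_or_eq.1 hp with h | h
        · simp only [h.le, Nat.succ_le_of_lt h, if_true]
          exact hdx p h
        · simp [h, hdr, hhi' p h, (hx p hp).2]

/-- Some interval of a subdivision contains a given point. -/
theorem exists_mem_Ico_succ {d : ℕ → ℝ} {x : ℝ} :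
    ∀ r : ℕ, x ∈ Set.Ico (d 0) (d r) → ∃ k < r, x ∈ Set.Ico (d k) (d (k + 1)) := by
  intro r
  induction r with
  | zero => intro h; simp at h
  | succ r ih =>
    intro h
    rcases lt_or_ge x (d r) with h' | h'
    · obtain ⟨k, hk, hx⟩ := ih ⟨h.1, h'⟩
      exact ⟨k, by omega, hx⟩
    · exact ⟨r, by omega, h', h.2⟩

/-- `g` is piecewise affine on `[l, r)`, with finitely many pieces. -/
def PiecewiseAffineOn (g : ℝ → ℝ) (l r : ℝ) : Prop :=
  ∃ (n : ℕ) (c : Fin (n + 1) → ℝ), StrictMono c ∧ c 0 = l ∧ c (Fin.last n) = r ∧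
    ∀ i : Fin n, ∃ s t : ℝ, ∀ x ∈ Set.Ico (c i.castSucc) (c i.succ), g x = s * x + t

theorem PiecewiseAffineOn.congr {g g' : ℝ → ℝ} {l r : ℝ} (h : PiecewiseAffineOn g l r)
    (hg : Set.EqOn g g' (Set.Ico l r)) : PiecewiseAffineOn g' l r := by
  obtain ⟨n, c, hc, h0, hl, ha⟩ := h
  refine ⟨n, c, hc, h0, hl, fun i => ?_⟩
  obtain ⟨s, t, hst⟩ := ha i
  refine ⟨s, t, fun x hx => ?_⟩
  rw [← hst x hx, hg]
  refine ⟨?_, ?_⟩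
  · rw [← h0]
    exact (hc.monotone (Fin.zero_le _)).trans hx.1
  · rw [← hl]
    exact hx.2.trans_le (hc.monotone (Fin.le_last _))

theorem PiecewiseAffineOn.snoc {g : ℝ → ℝ} {l m r : ℝ} (h : PiecewiseAffineOn g l m) (hmr : m < r)
    {s t : ℝ} (hst : ∀ x ∈ Set.Ico m r, g x = s * x + t) : PiecewiseAffineOn g l r := by
  obtain ⟨n, c, hc, h0, hl, ha⟩ := h
  refine ⟨n + 1, Fin.snoc (α := fun _ => ℝ) c r, ?_, ?_, by simp, fun i => ?_⟩
  · rw [Fin.strictMono_iff_lt_succ]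
    intro i
    induction i using Fin.lastCases with
    | last => simpa [hl] using hmr
    | cast i =>
      rw [← Fin.castSucc_succ, Fin.snoc_castSucc, Fin.snoc_castSucc]
      exact hc (Fin.castSucc_lt_succ)
  · rw [← Fin.castSucc_zero, Fin.snoc_castSucc, h0]
  · induction i using Fin.lastCases with
    | last =>
      refine ⟨s, t, fun x hx => hst x ?_⟩
      simpa [hl] using hx
    | cast i =>
      obtain ⟨s', t', h'⟩ := ha i
      refine ⟨s', t', fun x hx => h' x ?_⟩
      rwa [← Fin.castSucc_succ, Fin.snoc_castSucc, Fin.snoc_castSucc] at hx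

/-- Piecewise affine interpolation of strictly increasing data. -/
theorem exists_piecewiseAffine_interpolation (h : ℝ → ℝ) (l c : ℝ) (X : Finset ℝ) :
    ∀ r d : ℝ, l < r → c < d → StrictMonoOn h X →
    (∀ x ∈ X, (l < x ∧ x < r) ∧ c < h x ∧ h x < d) →
    ∃ g : ℝ → ℝ, ContinuousOn g (Set.Icc l r) ∧ StrictMonoOn g (Set.Icc l r) ∧ g l = c ∧ g r = d ∧
      (∀ x ∈ X, g x = h x) ∧ PiecewiseAffineOn g l r := by
  induction X using Finset.induction_on_max with
  | empty =>
    intro r d hlr hcd _ _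
    have hs : 0 < (d - c) / (r - l) := div_pos (by linarith) (by linarith)
    refine ⟨fun x => (d - c) / (r - l) * x + (c - (d - c) / (r - l) * l), by fun_prop, ?_, ?_, ?_,
      by simp, 1, ![l, r], ?_, rfl, rfl, fun i => ?_⟩
    · intro x _ y _ hxy
      simp only
      nlinarith
    · ring
    · have : r - l ≠ 0 := by linarith
      field_simp
      ring
    · rw [Fin.strictMono_iff_lt_succ]
      intro i
      fin_cases i
      simpa using hlr
    · exact ⟨_, _, fun x _ => rfl⟩
  | insert m X hmax ih =>
    intro r d hlr hcd hmono hX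
    obtain ⟨⟨hlm, hmr⟩, hcm, hmd⟩ := hX m (by simp)
    -- The largest data point `m` becomes the right end of the inductive interpolation, with end
    -- value `h m`. A single segment from `(m, h m)` to `(r, d)` completes it.
    obtain ⟨g, hgc, hgm, hgl, hgr, hgX, hpa⟩ := ih m (h m) hlm hcm
      (hmono.mono (by simp)) (fun x hx => by
        obtain ⟨⟨h1, _⟩, h2, _⟩ := hX x (by simp [hx])
        exact ⟨⟨h1, hmax x hx⟩, h2, hmono (by simp [hx]) (by simp) (hmax x hx)⟩)
    have hs : 0 < (d - h m) / (r - m) := div_pos (by linarith) (by linarith)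
    set s := (d - h m) / (r - m) with hsdef
    have hsr : s * r + (h m - s * m) = d := by
      have : r - m ≠ 0 := by linarith
      rw [hsdef]
      field_simp
      ring
    have e1 : Set.EqOn (fun x => if x ≤ m then g x else s * x + (h m - s * m)) g (Set.Icc l m) :=
      fun x hx => by simp [hx.2]
    have e2 : Set.EqOn (fun x => if x ≤ m then g x else s * x + (h m - s * m))
        (fun x => s * x + (h m - s * m)) (Set.Icc m r) := fun x hx => by
      rcases hx.1.eq_or_lt with rfl | hx'
      · simp [hgr]
      · simp [not_le.2 hx']
    have hun : Set.Icc l r = Set.Icc l m ∪ Set.Icc m r :=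
      (Set.Icc_union_Icc_eq_Icc hlm.le hmr.le).symm
    refine ⟨fun x => if x ≤ m then g x else s * x + (h m - s * m), ?_, ?_, ?_, ?_, ?_, ?_⟩
    · rw [hun]
      exact (hgc.congr e1).union_of_isClosed
        ((by fun_prop : ContinuousOn (fun x => s * x + (h m - s * m)) (Set.Icc m r)).congr e2)
        isClosed_Icc isClosed_Icc
    · rw [hun]
      refine StrictMonoOn.union (c := m) (hgm.congr e1.symm) ?_ ⟨⟨hlm.le, le_rfl⟩, fun x hx => hx.2⟩
        ⟨⟨le_rfl, hmr.le⟩, fun x hx => hx.1⟩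
      refine StrictMonoOn.congr ?_ e2.symm
      intro x _ y _ hxy
      simp only
      nlinarith
    · simp [hlm.le, hgl]
    · simp [not_le.2 hmr, hsr]
    · intro x hx
      rcases Finset.mem_insert.1 hx with rfl | hx
      · simp [hgr]
      · simp [(hmax x hx).le, hgX x hx]
    · exact (hpa.congr fun x hx => (e1 ⟨hx.1, hx.2.le⟩).symm).snoc hmr
        fun x hx => e2 ⟨hx.1, hx.2.le⟩

theorem lt_iff_lt_of_mem_Ico_succ {d : ℕ → ℝ} (hd : StrictMono d) {m n : ℕ} :
    (∀ x ∈ Set.Ico (d m) (d (m + 1)), ∀ y ∈ Set.Ico (d n) (d (n + 1)), x < y) ↔ m < n := by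
  constructor
  · intro h
    exact hd.lt_iff_lt.1 (h _ ⟨le_rfl, hd (Nat.lt_succ_self m)⟩ _ ⟨le_rfl, hd (Nat.lt_succ_self n)⟩)
  · intro h x hx y hy
    exact hx.2.trans_le ((hd.monotone h).trans hy.1)

theorem disjoint_Ico_succ {d : ℕ → ℝ} (hd : StrictMono d) {m n : ℕ} (h : m ≠ n) :
    Disjoint (Set.Ico (d m) (d (m + 1))) (Set.Ico (d n) (d (n + 1))) :=
  hd.monotone.pairwise_disjoint_on_Ico_succ h

theorem iUnion_Ico_succ {A : Type*} {r : ℕ} (ρ : A ≃ Fin r) {d : ℕ → ℝ} (hd : StrictMono d) :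
    ⋃ e, Set.Ico (d (ρ e)) (d (ρ e + 1)) = Set.Ico (d 0) (d r) := by
  ext x
  simp only [Set.mem_iUnion]
  constructor
  · rintro ⟨e, h1, h2⟩
    exact ⟨(hd.monotone (Nat.zero_le _)).trans h1, h2.trans_le (hd.monotone (ρ e).2)⟩
  · intro hx
    obtain ⟨k, hk, hx⟩ := exists_mem_Ico_succ r hx
    exact ⟨ρ.symm ⟨k, hk⟩, by simpa using hx⟩

/-- Finite data compatible with a pair of orders are realized by a piecewise affine generalized
interval exchange transformation with these orders. -/
theorem exists_genIET_interpolating {A P : Type*} [Finite P] {r : ℕ} (hr : 0 < r)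
    (rA rD : A ≃ Fin r) (a b : ℝ) (hab : a < b) (ℓ : P → A) (x y : P → ℝ)
    (hx : ∀ p, a < x p ∧ x p < b) (hy : ∀ p, a < y p ∧ y p < b)
    (hD : ∀ p q, rD (ℓ p) < rD (ℓ q) → x p < x q)
    (hA : ∀ p q, rA (ℓ p) < rA (ℓ q) → y p < y q)
    (hlt : ∀ p q, ℓ p = ℓ q → x p < x q → y p < y q)
    (heq : ∀ p q, ℓ p = ℓ q → x p = x q → y p = y q) :
    ∃ T : GenIET A, T.IsPiecewiseAffine ∧ (∀ e f, T.orderA e f ↔ rA e < rA f) ∧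
      (∀ e f, T.orderD e f ↔ rD e < rD f) ∧
      ∀ p, x p ∈ T.defInterval (ℓ p) ∧ T.toFun (x p) = y p := by
  classical
  have := Fintype.ofFinite P
  -- The cuts `d` bound the defining intervals in the order `rD`, and the cuts `c` bound their
  -- images in the order `rA`. Letters without data points also get nonempty intervals.
  obtain ⟨d, hd, hd0, hdr, hdx⟩ := exists_strictMono_separating a x (fun p => (rD (ℓ p) : ℕ)) r b
    hr hab (fun p _ => hx p) (fun p q _ _ h => hD p q h)
  obtain ⟨c, hc, hc0, hcr, hcy⟩ := exists_strictMono_separating a y (fun p => (rA (ℓ p) : ℕ)) r b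
    hr hab (fun p _ => hy p) (fun p q _ _ h => hA p q h)
  have hg : ∀ e, ∃ g : ℝ → ℝ, ContinuousOn g (Set.Icc (d (rD e)) (d (rD e + 1))) ∧
      StrictMonoOn g (Set.Icc (d (rD e)) (d (rD e + 1))) ∧ g (d (rD e)) = c (rA e) ∧
      g (d (rD e + 1)) = c (rA e + 1) ∧ (∀ p, ℓ p = e → g (x p) = y p) ∧
      PiecewiseAffineOn g (d (rD e)) (d (rD e + 1)) := by
    intro e
    -- By `heq`, the data over `e` form the graph of a function of the point. The value 0 elsewhere
    -- is never used.
    have hfac : ∃ h : ℝ → ℝ, ∀ p, ℓ p = e → h (x p) = y p := by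
      refine ⟨fun t => if ht : ∃ p, ℓ p = e ∧ x p = t then y ht.choose else 0, fun p hp => ?_⟩
      have ht : ∃ q, ℓ q = e ∧ x q = x p := ⟨p, hp, rfl⟩
      simp only [ht, dif_pos]
      exact heq _ _ (ht.choose_spec.1.trans hp.symm) ht.choose_spec.2
    obtain ⟨h, hh⟩ := hfac
    obtain ⟨g, h1, h2, h3, h4, h5, h6⟩ := exists_piecewiseAffine_interpolation h (d (rD e))
      (c (rA e)) ((Finset.univ.filter (fun p => ℓ p = e)).image x) (d (rD e + 1)) (c (rA e + 1))
      (hd (Nat.lt_succ_self _)) (hc (Nat.lt_succ_self _))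
      (by
        intro s hs t ht hst
        simp only [Finset.coe_image, Finset.coe_filter, Finset.mem_univ, true_and, Set.mem_image,
          Set.mem_ofPred_eq] at hs ht
        obtain ⟨p, hp, rfl⟩ := hs
        obtain ⟨q, hq, rfl⟩ := ht
        rw [hh p hp, hh q hq]
        exact hlt p q (hp.trans hq.symm) hst)
      (by
        intro s hs
        simp only [Finset.mem_image, Finset.mem_filter, Finset.mem_univ, true_and] at hs
        obtain ⟨p, rfl, rfl⟩ := hs
        rw [hh p rfl]
        exact ⟨hdx p (rD (ℓ p)).2, hcy p (rA (ℓ p)).2⟩)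
    exact ⟨g, h1, h2, h3, h4, fun p hp => by
      rw [h5 (x p) (Finset.mem_image_of_mem _ (by simp [hp])), hh p hp], h6⟩
  choose g hgc hgm hgl hgr hgx hgp using hg
  set D : A → Set ℝ := fun e => Set.Ico (d (rD e)) (d (rD e + 1)) with hDdef
  have hdisj : ∀ e f, e ≠ f → Disjoint (D e) (D f) := fun e f hef =>
    disjoint_Ico_succ hd fun h => hef (rD.injective (Fin.ext h))
  set F : ℝ → ℝ := fun t => if ht : ∃ e, t ∈ D e then g ht.choose t else t with hF
  have hFg : ∀ e, Set.EqOn (g e) F (D e) := by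
    intro e t ht
    have hex : ∃ e, t ∈ D e := ⟨e, ht⟩
    have : hex.choose = e := by
      by_contra hne
      exact Set.disjoint_left.1 (hdisj _ _ hne) hex.choose_spec ht
    simp only [hF, hex, dif_pos, this]
  have himg : ∀ e, F '' D e = Set.Ico (c (rA e)) (c (rA e + 1)) := by
    intro e
    have hle : d (rD e) ≤ d (rD e + 1) := hd.monotone (Nat.le_succ _)
    rw [← (hFg e).image_eq]
    apply Set.Subset.antisymm
    · rintro _ ⟨t, ht, rfl⟩
      rw [← hgl e, ← hgr e]
      exact ⟨(hgm e).monotoneOn ⟨le_rfl, hle⟩ ⟨ht.1, ht.2.le⟩ ht.1,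
        hgm e ⟨ht.1, ht.2.le⟩ ⟨hle, le_rfl⟩ ht.2⟩
    · rw [← hgl e, ← hgr e]
      exact intermediate_value_Ico hle (hgc e)
  let T : GenIET A :=
    { a := a
      b := b
      toFun := F
      left := fun e => d (rD e)
      right := fun e => d (rD e + 1)
      left_lt_right := fun e => hd (Nat.lt_succ_self _)
      disjoint_dom := hdisj
      iUnion_dom := by rw [iUnion_Ico_succ rD hd, hd0, hdr]
      continuousOn := fun e => ((hgc e).mono Set.Ico_subset_Icc_self).congr (hFg e).symm
      strictMonoOn := fun e => ((hgm e).mono Set.Ico_subset_Icc_self).congr (hFg e)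
      image_interval := fun e => ⟨_, _, himg e⟩
      disjoint_image := fun e f hef => by
        change Disjoint (F '' D e) (F '' D f)
        rw [himg, himg]
        exact disjoint_Ico_succ hc fun h => hef (rA.injective (Fin.ext h))
      iUnion_image := by
        change ⋃ e, F '' D e = _
        simp only [himg]
        rw [iUnion_Ico_succ rA hc, hc0, hcr] }
  refine ⟨T, fun e => (hgp e).congr (hFg e), fun e f => ?_, fun e f => ?_, fun p => ?_⟩
  · change (∀ x ∈ F '' D e, ∀ y ∈ F '' D f, x < y) ↔ _
    rw [himg, himg, lt_iff_lt_of_mem_Ico_succ hc]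
    rfl
  · exact lt_iff_lt_of_mem_Ico_succ hd
  · have hmem : x p ∈ D (ℓ p) :=
      ⟨(hdx p (rD (ℓ p)).2).1.le, (hdx p (rD (ℓ p)).2).2⟩
    exact ⟨hmem, by rw [← hgx _ p rfl]; exact (hFg _ hmem).symm⟩

/-! ### Orbits and natural codings. -/

namespace GenIET

theorem exists_mem_defInterval {A : Type*} (T : GenIET A) {x : ℝ} (hx : x ∈ T.domain) :
    ∃ e, x ∈ T.defInterval e := by
  rw [domain, ← T.iUnion_dom] at hx
  exact Set.mem_iUnion.1 hx

theorem defInterval_subset_domain {A : Type*} (T : GenIET A) (e : A) :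
    T.defInterval e ⊆ T.domain := by
  rw [domain, ← T.iUnion_dom]
  exact Set.subset_iUnion (fun e => Set.Ico (T.left e) (T.right e)) e

theorem eq_of_mem_defInterval {A : Type*} (T : GenIET A) {x : ℝ} {e f : A}
    (he : x ∈ T.defInterval e) (hf : x ∈ T.defInterval f) : e = f := by
  by_contra h
  exact Set.disjoint_left.1 (T.disjoint_dom e f h) he hf

/-- Both the defining intervals and their images partition the domain, and each branch is injective.
-/
theorem bijOn {A : Type*} (T : GenIET A) : Set.BijOn T.toFun T.domain T.domain := by
  refine ⟨fun x hx => ?_, fun x hx y hy hxy => ?_, fun y hy => ?_⟩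
  · obtain ⟨e, he⟩ := T.exists_mem_defInterval hx
    rw [domain, ← T.iUnion_image]
    exact Set.mem_iUnion.2 ⟨e, x, he, rfl⟩
  · obtain ⟨e, he⟩ := T.exists_mem_defInterval hx
    obtain ⟨f, hf⟩ := T.exists_mem_defInterval hy
    obtain rfl : e = f := by
      by_contra h
      exact Set.disjoint_left.1 (T.disjoint_image e f h) ⟨x, he, rfl⟩ ⟨y, hf, hxy.symm⟩
    exact (T.strictMonoOn e).injOn he hf hxy
  · rw [domain, ← T.iUnion_image] at hy
    obtain ⟨e, x, hx, rfl⟩ := Set.mem_iUnion.1 hy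
    exact ⟨x, T.defInterval_subset_domain e hx, rfl⟩

/-- Every point of the domain has a two-sided orbit. -/
theorem exists_orbit {A : Type*} (T : GenIET A) {x : ℝ} (hx : x ∈ T.domain) :
    ∃ u : ℤ → ℝ, u 0 = x ∧ (∀ n, u n ∈ T.domain) ∧ ∀ n, u (n + 1) = T.toFun (u n) := by
  -- As a permutation of the domain, the map has integer powers, which also supply the backward
  -- orbit.
  let E : Equiv.Perm T.domain := T.bijOn.equiv T.toFun
  refine ⟨fun n => ((E ^ n) ⟨x, hx⟩ : T.domain), by simp, fun n => Subtype.coe_prop _, fun n => ?_⟩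
  simp only [add_comm n, zpow_one_add]
  rfl

/-- A word read along a finite orbit segment belongs to the natural coding. -/
theorem mem_naturalCoding_of_segment {A : Type*} (T : GenIET A) {w : List A} {z : ℕ → ℝ}
    (h0 : z 0 ∈ T.domain) (hw : ∀ (i : ℕ) (hi : i < w.length), z i ∈ T.defInterval w[i])
    (hz : ∀ i < w.length, T.toFun (z i) = z (i + 1)) : w ∈ T.naturalCoding := by
  obtain ⟨u, hu0, hu, hus⟩ := T.exists_orbit h0
  choose ξ hξ using fun n => T.exists_mem_defInterval (hu n)
  have huz : ∀ i : ℕ, i ≤ w.length → u i = z i := by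
    intro i
    induction i with
    | zero => intro _; simpa using hu0
    | succ i ih =>
      intro hi
      rw [Nat.cast_succ, hus, ih (by omega), hz i (by omega)]
  refine ⟨ξ, ⟨u, hu, hus, hξ⟩, 0, fun i hi => ?_⟩
  have h1 := hξ i
  rw [huz i hi.le] at h1
  simpa using T.eq_of_mem_defInterval (hw i hi) h1

end GenIET

/-! ### Extending a language while keeping the order condition. -/

/-- The order condition without the restriction to bispecial words, for orders given by ranks. -/
def RankOrderCondition {A : Type*} {r : ℕ} (rA rD : A ≃ Fin r) (L : Set (List A)) : Prop :=
  ∀ (v : List A) (x x' y y' : A), x ≠ x' → y ≠ y' →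
    x :: (v ++ [y]) ∈ L → x' :: (v ++ [y']) ∈ L → (rA x < rA x' ↔ rD y < rD y')

/-- `L` contains the factors of its words. -/
def IsFactorial {A : Type*} (L : Set (List A)) : Prop :=
  ∀ w ∈ L, ∀ v, v <:+: w → v ∈ L

theorem isFactorial_factorsOf {A : Type*} (W : Set (List A)) : IsFactorial (factorsOf W) := by
  rintro w ⟨u, hu, hwu⟩ v hv
  exact ⟨u, hu, hv.trans hwu⟩

/-- In a factorial language, two words `xvy` and `x'vy'` with distinct end letters already make `v`
bispecial, so the restriction to bispecial words is vacuous. -/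
theorem orderCondition_iff_rank {A : Type*} {r : ℕ} {ltA ltD : A → A → Prop} (rA rD : A ≃ Fin r)
    (hA : ∀ a b, ltA a b ↔ rA a < rA b) (hD : ∀ a b, ltD a b ↔ rD a < rD b) {L : Set (List A)}
    (hL : IsFactorial L) : OrderCondition ltA ltD L ↔ RankOrderCondition rA rD L := by
  constructor
  · intro h v x x' y y' hx hy h1 h2
    rw [← hA, ← hD]
    have hxv : ∀ x y, x :: (v ++ [y]) ∈ L → x :: v ∈ L := fun x y h =>
      hL _ h _ ⟨[], [y], by simp⟩
    have hvy : ∀ x y, x :: (v ++ [y]) ∈ L → v ++ [y] ∈ L := fun x y h =>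
      hL _ h _ ⟨[x], [], by simp⟩
    have hv : v ∈ L := hL _ h1 _ ⟨[x], [y], by simp⟩
    exact h v ⟨⟨hv, x, x', hx, hxv x y h1, hxv x' y' h2⟩,
      ⟨hv, y, y', hy, hvy x y h1, hvy x' y' h2⟩⟩ x x' y y' hx hy h1 h2
  · intro h v _ x x' y y' hx hy h1 h2
    rw [hA, hD]
    exact h v x x' y y' hx hy h1 h2

theorem Equiv.not_lt_rank_iff {A : Type*} {r : ℕ} (ρ : A ≃ Fin r) {a b : A} (h : a ≠ b) :
    ¬ ρ a < ρ b ↔ ρ b < ρ a := by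
  rw [not_lt]
  exact ⟨fun h' => lt_of_le_of_ne h' fun he => h (ρ.injective he).symm, le_of_lt⟩

/-- A letter `y` that may follow a word with suffixes `x :: v` of `t`. -/
theorem exists_compatible_letter {A : Type*} {r : ℕ} (hr : 0 < r) (rA rD : A ≃ Fin r)
    {L : Set (List A)} (hL : IsFactorial L) (hoc : RankOrderCondition rA rD L) (t : List A) :
    ∃ y, ∀ x v, x :: v <:+ t → ∀ x' y', x ≠ x' → y ≠ y' → x' :: (v ++ [y']) ∈ L →
      (rA x < rA x' ↔ rD y < rD y') := by
  have hext : ∀ t y, t ++ [y] ∈ L → ∀ x v, x :: v <:+ t → ∀ x' y', x ≠ x' → y ≠ y' →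
      x' :: (v ++ [y']) ∈ L → (rA x < rA x' ↔ rD y < rD y') := by
    rintro t y hty x v ⟨s, rfl⟩ x' y' hx hy h
    exact hoc v x x' y y' hx hy (hL _ hty _ ⟨s, [], by simp⟩) h
  have : Finite A := Finite.of_equiv _ rA.symm
  induction t with
  | nil => exact ⟨rA.symm ⟨0, hr⟩, fun x v h => by simp at h⟩
  | cons x v ih =>
    -- If `v` has a right extension `vy` in `L`, the order condition of `L` settles all suffixes of
    -- `v`, so only the full suffix `x :: v` constrains the choice of `y`.
    by_cases hxv : ∃ y, v ++ [y] ∈ L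
    · obtain ⟨y₀, hy₀⟩ := hxv
      obtain ⟨y, hvy, hup, hdown⟩ : ∃ y, v ++ [y] ∈ L ∧
          (∀ x' y', rA x < rA x' → x' :: (v ++ [y']) ∈ L → rD y ≤ rD y') ∧
          (∀ x' y', rA x' < rA x → x' :: (v ++ [y']) ∈ L → rD y' ≤ rD y) := by
        have hright : ∀ x' y', x' :: (v ++ [y']) ∈ L → v ++ [y'] ∈ L := fun x' y' h =>
          hL _ h _ ⟨[x'], [], by simp⟩
        -- The letter `y` must lie below all letters following `x'v` with `x <_A x'` and above all
        -- those with `x' <_A x`, equality being allowed. The least letter of the first kind works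
        -- because the order condition puts the second kind below it. If there is none of the first
        -- kind, the greatest of the second kind is taken, and otherwise any letter following `v`.
        by_cases hU : {y | ∃ x', rA x < rA x' ∧ x' :: (v ++ [y]) ∈ L}.Nonempty
        · obtain ⟨y, ⟨x₁, hx₁, h₁⟩, hmin⟩ := Set.exists_min_image _ rD (Set.toFinite _) hU
          refine ⟨y, hright _ _ h₁, fun x' y' hx' h' => hmin y' ⟨x', hx', h'⟩,
            fun x' y' hx' h' => ?_⟩
          by_cases hy : y' = y
          · rw [hy]
          · have hlt := hx'.trans hx₁
            exact ((hoc v x' x₁ y' y (fun he => by simp [he] at hlt) hy h' h₁).1 hlt).le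
        · have hU' : ∀ x' y', rA x < rA x' → x' :: (v ++ [y']) ∉ L := fun x' y' hx' h' =>
            hU ⟨y', x', hx', h'⟩
          by_cases hD : {y | ∃ x', rA x' < rA x ∧ x' :: (v ++ [y]) ∈ L}.Nonempty
          · obtain ⟨y, ⟨x₁, hx₁, h₁⟩, hmax⟩ := Set.exists_max_image _ rD (Set.toFinite _) hD
            exact ⟨y, hright _ _ h₁, fun x' y' hx' h' => absurd h' (hU' x' y' hx'),
              fun x' y' hx' h' => hmax y' ⟨x', hx', h'⟩⟩
          · exact ⟨y₀, hy₀, fun x' y' hx' h' => absurd h' (hU' x' y' hx'),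
              fun x' y' hx' h' => absurd ⟨y', x', hx', h'⟩ hD⟩
      refine ⟨y, fun z u hzu x' y' hx hy h => ?_⟩
      rcases List.suffix_cons_iff.1 hzu with he | hs
      · obtain ⟨rfl, rfl⟩ := List.cons.inj he
        have hne : rD y ≠ rD y' := fun he => hy (rD.injective he)
        constructor
        · intro hlt
          exact lt_of_le_of_ne (hup x' y' hlt h) hne
        · intro hlt
          by_contra hnot
          exact absurd hlt (not_lt.2 (hdown x' y' ((rA.not_lt_rank_iff hx).1 hnot) h))
      · exact hext v y hvy z u hs x' y' hx hy h
    -- When nothing follows `v` in `L`, the suffix `x :: v` imposes no constraint and the letter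
    -- found for `v` still works.
    · obtain ⟨y, hy⟩ := ih
      refine ⟨y, fun z u hzu x' y' hx hy' h => ?_⟩
      rcases List.suffix_cons_iff.1 hzu with he | hs
      · obtain ⟨rfl, rfl⟩ := List.cons.inj he
        exact absurd ⟨y', hL _ h _ ⟨[x'], [], by simp⟩⟩ hxv
      · exact hy z u hs x' y' hx hy' h

/-- A word of a factorial language with the order condition can be extended to the right. -/
theorem exists_right_extension {A : Type*} {r : ℕ} (hr : 0 < r) (rA rD : A ≃ Fin r)
    {L : Set (List A)} (hL : IsFactorial L) (hoc : RankOrderCondition rA rD L) {w : List A}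
    (hw : w ∈ L) : ∃ y, ∃ L' : Set (List A), IsFactorial L' ∧ RankOrderCondition rA rD L' ∧
      L ⊆ L' ∧ w ++ [y] ∈ L' := by
  obtain ⟨y, hy⟩ := exists_compatible_letter hr rA rD hL hoc w
  -- Adding the suffixes of `wy` is enough, since every other factor of `wy` is a factor of `w`. Two
  -- new words both end in `y`, so the order condition is only at stake between a new word and an
  -- old one.
  refine ⟨y, L ∪ {v | v <:+ w ++ [y]}, ?_, ?_, Set.subset_union_left,
    Or.inr (List.suffix_refl _)⟩
  · rintro u (hu | hu) v hv
    · exact Or.inl (hL u hu v hv)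
    · rcases List.infix_concat_iff.1 (hv.trans hu.isInfix) with h | h
      · exact Or.inr h
      · exact Or.inl (hL w hw v h)
  · have hsuf : ∀ x v z, x :: (v ++ [z]) <:+ w ++ [y] → z = y ∧ x :: v <:+ w := by
      rintro x v z ⟨s, hs⟩
      have hs' : (s ++ x :: v) ++ [z] = w ++ [y] := by simpa using hs
      obtain ⟨h1, h2⟩ := List.append_inj' hs' rfl
      exact ⟨by simpa using h2, s, h1⟩
    rintro v x x' z z' hx hz (h1 | h1) (h2 | h2)
    · exact hoc v x x' z z' hx hz h1 h2
    · obtain ⟨rfl, hs⟩ := hsuf _ _ _ h2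
      have := hy x' v hs x z hx.symm hz.symm h1
      rw [← rA.not_lt_rank_iff hx.symm, ← rD.not_lt_rank_iff hz.symm, this]
    · obtain ⟨rfl, hs⟩ := hsuf _ _ _ h1
      exact hy x v hs x' z' hx hz h2
    · exact absurd ((hsuf _ _ _ h1).1.trans (hsuf _ _ _ h2).1.symm) hz

/-- A factorial language with the order condition is contained in one whose words can all be
extended to the right. -/
theorem exists_right_extendable {A : Type*} {r : ℕ} (hr : 0 < r) (rA rD : A ≃ Fin r)
    {L : Set (List A)} (hL : IsFactorial L) (hoc : RankOrderCondition rA rD L) :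
    ∃ M : Set (List A), L ⊆ M ∧ IsFactorial M ∧ RankOrderCondition rA rD M ∧
      ∀ w ∈ M, ∃ y, w ++ [y] ∈ M := by
  obtain ⟨M, hLM, hM⟩ := zorn_subset_nonempty
    {L | IsFactorial L ∧ RankOrderCondition rA rD L} (by
      intro c hc hchain hne
      refine ⟨⋃₀ c, ⟨?_, ?_⟩, fun s hs => Set.subset_sUnion_of_mem hs⟩
      · rintro w ⟨s, hs, hw⟩ v hv
        exact ⟨s, hs, (hc hs).1 w hw v hv⟩
      -- The condition involves only two words at a time, and both lie in a common member of the
      -- chain.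
      · rintro v x x' y y' hx hy ⟨s, hs, h1⟩ ⟨s', hs', h2⟩
        rcases hchain.total hs hs' with h | h
        · exact (hc hs').2 v x x' y y' hx hy (h h1) h2
        · exact (hc hs).2 v x x' y y' hx hy h1 (h h2)) L ⟨hL, hoc⟩
  refine ⟨M, hLM, hM.prop.1, hM.prop.2, fun w hw => ?_⟩
  obtain ⟨y, L', h1, h2, h3, h4⟩ := exists_right_extension hr rA rD hM.prop.1 hM.prop.2 hw
  exact ⟨y, hM.le_of_ge ⟨h1, h2⟩ h3 h4⟩

/-- Words of a factorial right extendable language are prefixes of infinite words with all factors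
in the language. -/
theorem exists_infinite_extension {A : Type*} {M : Set (List A)} (hM : IsFactorial M)
    (hext : ∀ w ∈ M, ∃ y, w ++ [y] ∈ M) {w : List A} (hw : w ∈ M) :
    ∃ f : ℕ → A, (∀ (i : ℕ) (hi : i < w.length), w[i] = f i) ∧
      ∀ i n, (List.range n).map (fun k => f (i + k)) ∈ M := by
  obtain ⟨y₀, -⟩ := hext w hw
  have : Nonempty A := ⟨y₀⟩
  choose! next hnext using hext
  let u : ℕ → List A := fun n => (fun v => v ++ [next v])^[n] w
  have hu0 : u 0 = w := rfl
  have hus : ∀ n, u (n + 1) = u n ++ [next (u n)] := fun n => Function.iterate_succ_apply' _ _ _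
  have huM : ∀ n, u n ∈ M := by
    intro n
    induction n with
    | zero => exact hw
    | succ n ih => rw [hus]; exact hnext _ ih
  have hlen : ∀ n, (u n).length = w.length + n := by
    intro n
    induction n with
    | zero => rfl
    | succ n ih => rw [hus, List.length_append, ih]; rfl
  have hpre : ∀ m n, m ≤ n → u m <+: u n := by
    intro m n hmn
    induction n, hmn using Nat.le_induction with
    | base => exact List.prefix_refl _
    | succ n _ ih => rw [hus]; exact ih.trans (List.prefix_append _ _)
  -- The word `u (k + 1)` has length at least `k + 1` even if `w` is empty, so its letter at index
  -- `k` exists.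
  let f : ℕ → A := fun k => (u (k + 1))[k]'(by rw [hlen]; omega)
  have hf : ∀ n k (hk : k < (u n).length), (u n)[k] = f k := by
    intro n k hk
    rcases le_total n (k + 1) with h | h
    · exact (hpre _ _ h).getElem hk
    · exact ((hpre _ _ h).getElem (by rw [hlen]; omega)).symm
  refine ⟨f, fun i hi => hf 0 i hi, fun i n => ?_⟩
  have : (List.range n).map (fun k => f (i + k)) = ((u (i + n)).drop i).take n := by
    apply List.ext_getElem
    · simp [hlen]
      omega
    · intro k h1 h2
      simp [hf]
  rw [this]
  exact hM _ (huM (i + n)) _ ((List.take_prefix _ _).isInfix.trans (List.drop_suffix _ _).isInfix)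

/-! ### Ordering the positions of infinite words. -/

/-- The order condition for the infinite words `f j`. -/
def InfiniteOrderCondition {A J : Type*} {r : ℕ} (rA rD : A ≃ Fin r) (f : J → ℕ → A) : Prop :=
  ∀ j j' i i' n, (∀ k < n, f j (i + 1 + k) = f j' (i' + 1 + k)) → f j i ≠ f j' i' →
    f j (i + 1 + n) ≠ f j' (i' + 1 + n) →
    (rA (f j i) < rA (f j' i') ↔ rD (f j (i + 1 + n)) < rD (f j' (i' + 1 + n)))

theorem infiniteOrderCondition_of_factors {A J : Type*} {r : ℕ} {rA rD : A ≃ Fin r}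
    {M : Set (List A)} (hM : RankOrderCondition rA rD M) {f : J → ℕ → A}
    (hf : ∀ j i n, (List.range n).map (fun k => f j (i + k)) ∈ M) :
    InfiniteOrderCondition rA rD f := by
  have key : ∀ j i n, f j i :: ((List.range n).map (fun k => f j (i + 1 + k)) ++
      [f j (i + 1 + n)]) = (List.range (n + 2)).map (fun k => f j (i + k)) := by
    intro j i n
    rw [List.range_succ_eq_map, List.range_succ]
    simp [Function.comp_def, Nat.succ_add_eq_add_succ]
  intro j j' i i' n hagree hx hy
  refine hM ((List.range n).map (fun k => f j (i + 1 + k))) _ _ _ _ hx hy ?_ ?_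
  · rw [key]
    exact hf j i _
  · have : (List.range n).map (fun k => f j (i + 1 + k)) =
        (List.range n).map (fun k => f j' (i' + 1 + k)) :=
      List.map_congr_left fun k hk => hagree k (List.mem_range.1 hk)
    rw [this, key]
    exact hf j' i' _

/-- The ranks of the letters of `f` from position `i` on. -/
def futureRanks {A : Type*} {r : ℕ} (rD : A ≃ Fin r) (f : ℕ → A) (i : ℕ) : Lex (ℕ → ℕ) :=
  toLex fun k => (rD (f (i + k)) : ℕ)

/-- The ranks, increased by one, of the letters of `f` before position `i`, read backwards and
padded by zeros. -/
def pastRanks {A : Type*} {r : ℕ} (rA : A ≃ Fin r) (f : ℕ → A) (i : ℕ) : Lex (ℕ → ℕ) :=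
  toLex fun k => if k < i then (rA (f (i - 1 - k)) : ℕ) + 1 else 0

/-- Positions in infinite words are ordered by their future, then by their past. -/
def positionKey {A : Type*} {r : ℕ} (rA rD : A ≃ Fin r) (f : ℕ → A) (i : ℕ) :
    Lex (ℕ → ℕ) ×ₗ Lex (ℕ → ℕ) :=
  toLex (futureRanks rD f i, pastRanks rA f i)

theorem futureRanks_lt_iff {A : Type*} {r : ℕ} (rD : A ≃ Fin r) {f g : ℕ → A} {i j : ℕ} :
    futureRanks rD f i < futureRanks rD g j ↔
      ∃ n, (∀ k < n, f (i + k) = g (j + k)) ∧ rD (f (i + n)) < rD (g (j + n)) := by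
  have h : ∀ a b : A, (rD a : ℕ) = rD b ↔ a = b := fun a b => by
    rw [Fin.val_inj, rD.apply_eq_iff_eq]
  change (∃ n, (∀ k < n, (rD (f (i + k)) : ℕ) = rD (g (j + k))) ∧
    (rD (f (i + n)) : ℕ) < rD (g (j + n))) ↔ _
  simp only [h, Fin.lt_def]

theorem futureRanks_eq_iff {A : Type*} {r : ℕ} (rD : A ≃ Fin r) {f g : ℕ → A} {i j : ℕ} :
    futureRanks rD f i = futureRanks rD g j ↔ ∀ k, f (i + k) = g (j + k) := by
  have h : ∀ a b : A, (rD a : ℕ) = rD b ↔ a = b := fun a b => by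
    rw [Fin.val_inj, rD.apply_eq_iff_eq]
  rw [futureRanks, futureRanks, toLex_inj, funext_iff]
  simp only [h]

theorem pastRanks_succ_zero {A : Type*} {r : ℕ} (rA : A ≃ Fin r) (f : ℕ → A) (i : ℕ) :
    ofLex (pastRanks rA f (i + 1)) 0 = rA (f i) + 1 := by
  simp [pastRanks]

theorem pastRanks_succ_succ {A : Type*} {r : ℕ} (rA : A ≃ Fin r) (f : ℕ → A) (i k : ℕ) :
    ofLex (pastRanks rA f (i + 1)) (k + 1) = ofLex (pastRanks rA f i) k := by
  have : i - (k + 1) = i - 1 - k := by omega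
  simp [pastRanks, this]

theorem Pi.Lex.lt_iff_nat {a b : Lex (ℕ → ℕ)} :
    a < b ↔ ∃ n, (∀ k < n, ofLex a k = ofLex b k) ∧ ofLex a n < ofLex b n :=
  Iff.rfl

theorem positionKey_lt_of_letter_lt {A : Type*} {r : ℕ} (rA rD : A ≃ Fin r) {f g : ℕ → A}
    {i j : ℕ} (h : rD (f i) < rD (g j)) : positionKey rA rD f i < positionKey rA rD g j := by
  rw [positionKey, positionKey, Prod.Lex.toLex_lt_toLex]
  exact Or.inl ((futureRanks_lt_iff rD).2 ⟨0, by simp, h⟩)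

/-- The shift removes a common leading entry from the two futures and puts a common entry in front
of the two pasts, so neither lexicographic comparison changes. This makes the interpolated map
increasing on each defining interval. -/
theorem positionKey_succ_lt {A : Type*} {r : ℕ} (rA rD : A ≃ Fin r) {f g : ℕ → A}
    {i j : ℕ} (h : f i = g j) (hlt : positionKey rA rD f i < positionKey rA rD g j) :
    positionKey rA rD f (i + 1) < positionKey rA rD g (j + 1) := by
  rw [positionKey, positionKey, Prod.Lex.toLex_lt_toLex] at hlt ⊢
  simp only [futureRanks_lt_iff, futureRanks_eq_iff] at hlt ⊢
  rw [Pi.Lex.lt_iff_nat] at hlt ⊢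
  rcases hlt with ⟨n, hn, hlt⟩ | ⟨heq, n, hn, hlt⟩
  · left
    rcases n with _ | n
    · simp [h] at hlt
    · exact ⟨n, fun k hk => by simpa [Nat.succ_add_eq_add_succ] using hn (k + 1) (by omega),
        by simpa [Nat.succ_add_eq_add_succ] using hlt⟩
  · right
    refine ⟨fun k => by simpa [Nat.succ_add_eq_add_succ] using heq (k + 1), n + 1, fun k hk => ?_, ?_⟩
    · rcases k with _ | k
      · rw [pastRanks_succ_zero, pastRanks_succ_zero, h]
      · rw [pastRanks_succ_succ, pastRanks_succ_succ, hn k (by omega)]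
    · rwa [pastRanks_succ_succ, pastRanks_succ_succ]

/-- The letter that passes into the past is the first letter of the future, hence determined by the
key. Thus the shift is well defined on keys. -/
theorem positionKey_succ_eq {A : Type*} {r : ℕ} (rA rD : A ≃ Fin r) {f g : ℕ → A}
    {i j : ℕ} (heq : positionKey rA rD f i = positionKey rA rD g j) :
    positionKey rA rD f (i + 1) = positionKey rA rD g (j + 1) := by
  rw [positionKey, positionKey, toLex_inj, Prod.mk.injEq, futureRanks_eq_iff] at heq ⊢
  obtain ⟨h1, h2⟩ := heq
  refine ⟨fun k => by simpa [Nat.succ_add_eq_add_succ] using h1 (k + 1), ?_⟩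
  apply ofLex.injective
  funext k
  rcases k with _ | k
  · rw [pastRanks_succ_zero, pastRanks_succ_zero]
    exact congrArg (fun a => (rA a : ℕ) + 1) (h1 0)
  · rw [pastRanks_succ_succ, pastRanks_succ_succ, h2]

/-- The order condition enters here: at the first disagreement of the futures, it forces the order
given by the preceding letters. If the futures coincide, those letters are the first entries of the
pasts and break the tie. -/
theorem positionKey_succ_lt_of_letter_lt {A J : Type*} {r : ℕ} {rA rD : A ≃ Fin r} {f : J → ℕ → A}
    (hf : InfiniteOrderCondition rA rD f) {j j' : J} {i i' : ℕ}
    (h : rA (f j i) < rA (f j' i')) :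
    positionKey rA rD (f j) (i + 1) < positionKey rA rD (f j') (i' + 1) := by
  have hne : f j i ≠ f j' i' := fun he => by simp [he] at h
  rw [positionKey, positionKey, Prod.Lex.toLex_lt_toLex]
  rcases lt_trichotomy (futureRanks rD (f j) (i + 1)) (futureRanks rD (f j') (i' + 1)) with
    hlt | heq | hgt
  · exact Or.inl hlt
  · refine Or.inr ⟨heq, Pi.Lex.lt_iff_nat.2 ⟨0, by simp, ?_⟩⟩
    rw [pastRanks_succ_zero, pastRanks_succ_zero]
    exact Nat.succ_lt_succ h
  · obtain ⟨n, hn, hlt⟩ := (futureRanks_lt_iff rD).1 hgt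
    have := (hf j j' i i' n (fun k hk => (hn k hk).symm) hne
      (fun he => by simp [he] at hlt)).1 h
    exact absurd this hlt.not_gt

/-- A finite type with a strict total order is ranked by an initial segment of the integers. -/
theorem exists_rank {A : Type*} [Finite A] (lt : A → A → Prop) [IsStrictTotalOrder A lt] :
    ∃ ρ : A ≃ Fin (Nat.card A), ∀ a b, lt a b ↔ ρ a < ρ b := by
  classical
  have := Fintype.ofFinite A
  let _ : LinearOrder A := linearOrderOfSTO lt
  let e := Fintype.orderIsoFinOfCardEq A (Nat.card_eq_fintype_card (α := A)).symm
  exact ⟨e.symm.toEquiv, fun a b => (e.symm.lt_iff_lt (x := a) (y := b)).symm⟩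

/-! ### From transformations to the order condition, and back. -/

/-- The natural coding of a generalized interval exchange satisfies the order condition. -/
theorem GenIET.rankOrderCondition_naturalCoding {A : Type*} {r : ℕ} (rA rD : A ≃ Fin r)
    (T : GenIET A) (hA : ∀ e f, T.orderA e f ↔ rA e < rA f)
    (hD : ∀ e f, T.orderD e f ↔ rD e < rD f) : RankOrderCondition rA rD T.naturalCoding := by
  have orbit : ∀ x v y, x :: (v ++ [y]) ∈ T.naturalCoding → ∃ u : ℕ → ℝ,
      (∀ n, u (n + 1) = T.toFun (u n)) ∧ u 0 ∈ T.defInterval x ∧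
      (∀ (i : ℕ) (hi : i < v.length), u (i + 1) ∈ T.defInterval v[i]) ∧
      u (v.length + 1) ∈ T.defInterval y := by
    rintro x v y ⟨ξ, ⟨u, _, hus, hξ⟩, k, hk⟩
    refine ⟨fun n => u (k + n), fun n => ?_, ?_, fun i hi => ?_, ?_⟩
    · simp only [← hus, Nat.cast_succ, add_assoc]
    · have := hk 0 (by simp)
      simp only [List.getElem_cons_zero] at this
      rw [this]
      exact hξ _
    · have := hk (i + 1) (by simp; omega)
      simp only [List.getElem_cons_succ, List.getElem_append_left hi] at this
      rw [this]
      exact hξ _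
    · have := hk (v.length + 1) (by simp)
      simp only [List.getElem_cons_succ, List.getElem_concat_length] at this
      rw [this]
      exact hξ _
  have hlt : ∀ v x x' y y', y ≠ y' → x :: (v ++ [y]) ∈ T.naturalCoding →
      x' :: (v ++ [y']) ∈ T.naturalCoding → rA x < rA x' → rD y < rD y' := by
    intro v x x' y y' hy h1 h2 hx
    obtain ⟨u, hus, hu0, huv, huy⟩ := orbit _ _ _ h1
    obtain ⟨u', hus', hu0', huv', huy'⟩ := orbit _ _ _ h2
    -- The letters `x` and `x'` order the first images, and each common letter of `v` preserves this
    -- order.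
    have hmono : ∀ i ≤ v.length, u (i + 1) < u' (i + 1) := by
      intro i
      induction i with
      | zero =>
        intro _
        rw [hus, hus']
        exact (hA x x').2 hx _ ⟨_, hu0, rfl⟩ _ ⟨_, hu0', rfl⟩
      | succ i ih =>
        intro hi
        rw [hus (i + 1), hus' (i + 1)]
        exact T.strictMonoOn _ (huv i hi) (huv' i hi) (ih (by omega))
    by_contra hnot
    exact lt_asymm (hmono _ le_rfl) ((hD y' y).2 ((rD.not_lt_rank_iff hy).1 hnot) _ huy' _ huy)
  intro v x x' y y' hx hy h1 h2
  refine ⟨hlt v x x' y y' hy h1 h2, fun h => ?_⟩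
  by_contra hnot
  exact lt_asymm h (hlt v x' x y' y hy.symm h2 h1 ((rA.not_lt_rank_iff hx).1 hnot))

/-- Finite prefixes of finitely many infinite words with the order condition are coded by a
piecewise affine generalized interval exchange transformation. -/
theorem exists_genIET_coding {A J : Type*} [Finite J] {r : ℕ} (hr : 0 < r) (rA rD : A ≃ Fin r)
    {f : J → ℕ → A} (hf : InfiniteOrderCondition rA rD f) (m : ℕ) :
    ∃ T : GenIET A, T.IsPiecewiseAffine ∧ (∀ e f, T.orderA e f ↔ rA e < rA f) ∧
      (∀ e f, T.orderD e f ↔ rD e < rD f) ∧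
      ∃ z : J → ℕ → ℝ, ∀ j, ∀ i ≤ m, z j i ∈ T.defInterval (f j i) ∧
        T.toFun (z j i) = z j (i + 1) := by
  classical
  have := Fintype.ofFinite J
  let key : J → ℕ → Lex (ℕ → ℕ) ×ₗ Lex (ℕ → ℕ) := fun j i => positionKey rA rD (f j) i
  -- The range `m + 2` covers the positions up to `m` together with their successors.
  let K : Finset (Lex (ℕ → ℕ) ×ₗ Lex (ℕ → ℕ)) :=
    (Finset.univ ×ˢ Finset.range (m + 2)).image fun p : J × ℕ => key p.1 p.2
  have hK : ∀ j, ∀ i < m + 2, key j i ∈ K := fun j i hi =>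
    Finset.mem_image.2 ⟨(j, i), by simpa using hi, rfl⟩
  -- Counting the smaller keys embeds `K` in the real line preserving the order. The values lie
  -- between 0 and the cardinality of `K`, hence strictly inside the domain from -1 to that
  -- cardinality plus 1.
  let φ : Lex (ℕ → ℕ) ×ₗ Lex (ℕ → ℕ) → ℝ := fun κ => ((K.filter (· < κ)).card : ℝ)
  have hφ : ∀ κ ∈ K, ∀ κ', κ < κ' → φ κ < φ κ' := by
    intro κ hκ κ' h
    refine Nat.cast_lt.2 (Finset.card_lt_card ⟨fun τ hτ => ?_, fun hsub => ?_⟩)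
    · rw [Finset.mem_filter] at hτ ⊢
      exact ⟨hτ.1, hτ.2.trans h⟩
    · exact lt_irrefl κ (Finset.mem_filter.1 (hsub (Finset.mem_filter.2 ⟨hκ, h⟩))).2
  have hφK : ∀ κ, (-1 : ℝ) < φ κ ∧ φ κ < K.card + 1 := by
    intro κ
    have h1 : (0 : ℝ) ≤ φ κ := Nat.cast_nonneg _
    have h2 : φ κ ≤ K.card := Nat.cast_le.2 (Finset.card_filter_le _ _)
    exact ⟨by linarith, by linarith⟩
  have hlt_of : ∀ κ ∈ K, ∀ κ' ∈ K, φ κ < φ κ' → κ < κ' := by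
    intro κ hκ κ' hκ' h
    rcases lt_trichotomy κ κ' with h' | rfl | h'
    · exact h'
    · exact absurd h (lt_irrefl _)
    · exact absurd h (hφ κ' hκ' κ h').not_gt
  have heq_of : ∀ κ ∈ K, ∀ κ' ∈ K, φ κ = φ κ' → κ = κ' := by
    intro κ hκ κ' hκ' h
    rcases lt_trichotomy κ κ' with h' | h' | h'
    · exact absurd h (hφ κ hκ κ' h').ne
    · exact h'
    · exact absurd h (hφ κ' hκ' κ h').ne'
  have hmem : ∀ p : J × Fin (m + 1), key p.1 p.2 ∈ K := fun p => hK _ _ (by omega)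
  have hmem' : ∀ p : J × Fin (m + 1), key p.1 (p.2 + 1) ∈ K := fun p => hK _ _ (by omega)
  obtain ⟨T, hpa, hA, hD, hT⟩ := exists_genIET_interpolating (P := J × Fin (m + 1)) hr rA rD
    (-1) (K.card + 1) ((by norm_num : (-1 : ℝ) < 0).trans (by positivity)) (fun p => f p.1 p.2)
    (fun p => φ (key p.1 p.2)) (fun p => φ (key p.1 (p.2 + 1)))
    (fun p => hφK _) (fun p => hφK _)
    (fun p q h => hφ _ (hmem p) _ (positionKey_lt_of_letter_lt rA rD h))
    (fun p q h => hφ _ (hmem' p) _ (positionKey_succ_lt_of_letter_lt hf h))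
    (fun p q h hlt => hφ _ (hmem' p) _
      (positionKey_succ_lt rA rD h (hlt_of _ (hmem p) _ (hmem q) hlt)))
    (fun p q _ h => congrArg φ (positionKey_succ_eq rA rD (heq_of _ (hmem p) _ (hmem q) h)))
  exact ⟨T, hpa, hA, hD, fun j i => φ (key j i), fun j i hi => hT (j, ⟨i, by omega⟩)⟩

theorem mainTheorem10 {A : Type*} [Finite A] [Nonempty A] (ltA ltD : A → A → Prop)
    [IsStrictTotalOrder A ltA] [IsStrictTotalOrder A ltD]
    (W : Set (List A)) (hW : W.Finite) :
    OrderCondition ltA ltD (factorsOf W) ↔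
      ∃ L : Set (List A), IsGroupedCoding ltA ltD L ∧ W ⊆ L := by
  obtain ⟨rA, hA⟩ := exists_rank ltA
  obtain ⟨rD, hD⟩ := exists_rank ltD
  have hfac := isFactorial_factorsOf W
  rw [orderCondition_iff_rank rA rD hA hD hfac]
  constructor
  · intro hoc
    obtain ⟨M, hWM, hM, hMoc, hext⟩ := exists_right_extendable Nat.card_pos rA rD hfac hoc
    have : Finite W := hW
    choose f hfw hfM using fun w : W => exists_infinite_extension hM hext
      (hWM ⟨w, w.2, List.infix_refl _⟩)
    -- Since `W` is finite, a single bound `m` on the lengths suffices to read all its words along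
    -- finite orbit segments.
    obtain ⟨m, hm⟩ := (hW.image List.length).bddAbove
    obtain ⟨T, hpa, hTA, hTD, z, hz⟩ := exists_genIET_coding Nat.card_pos rA rD
      (infiniteOrderCondition_of_factors hMoc hfM) m
    refine ⟨T.naturalCoding, ⟨T, hpa, fun e f => (hTA e f).trans (hA e f).symm,
      fun e f => (hTD e f).trans (hD e f).symm, rfl⟩, fun w hw => ?_⟩
    have hwm : w.length ≤ m := hm ⟨w, hw, rfl⟩
    refine T.mem_naturalCoding_of_segment (z := z ⟨w, hw⟩)
      (T.defInterval_subset_domain _ (hz _ 0 (Nat.zero_le _)).1) (fun i hi => ?_)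
      (fun i hi => (hz _ i (by omega)).2)
    rw [hfw ⟨w, hw⟩ i hi]
    exact (hz _ i (by omega)).1
  · rintro ⟨_, ⟨T, _, hTA, hTD, rfl⟩, hWL⟩
    have hoc := T.rankOrderCondition_naturalCoding rA rD (fun e f => (hTA e f).trans (hA e f))
      (fun e f => (hTD e f).trans (hD e f))
    have hsub : factorsOf W ⊆ T.naturalCoding := by
      rintro _ ⟨w, hw, s, t, rfl⟩
      obtain ⟨ξ, hξ, k, hk⟩ := hWL hw
      refine ⟨ξ, hξ, k + s.length, fun i hi => ?_⟩
      have := hk (s.length + i) (by simp; omega)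
      rw [List.getElem_append_left (by simp; omega), List.getElem_append_right (by omega)] at this
      simpa [add_assoc] using this
    exact fun v x x' y y' hx hy h1 h2 => hoc v x x' y y' hx hy (hsub h1) (hsub h2)
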